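/- Let $\mathbb{H}$ be the complex upper half-plane and let $j:\mathbb{H}\to\mathbb{C}$ be the modular $j$-function, that is, the unique $\mathrm{SL}_2(\mathbb{Z})$-invariant holomorphic function with a $q$-expansion of the form $j(z)=q^{-1}+744+\sum_{k\ge 1}a_kq^k$, $q=e^{2\pi i z}$; explicitly, $j=E_4^3/\Delta$. For a polynomial $F\in\mathbb{C}[X,Y_0,Y_1,Y_2]$, say that the equation $F(z,j(z),j'(z),j''(z))=0$ has a Zariski dense set of solutions if for every $G\in\mathbb{C}[X,Y_0,Y_1,Y_2]$ that is not divisible by some irreducible factor of $F$ (i.e. there is an irreducible $p$ with $p\mid F$ and $p\nmid G$) there is $z_0\in\mathbb{H}$ such that $F(z_0,j(z_0),j'(z_0),j''(z_0))=0$ and $G(z_0,j(z_0),j'(z_0),j''(z_0))\neq 0$. Corollary 6.3. For every $u\in\mathbb{C}$, the equation $j(z)-u=0$ (that is, the equation given by $F=Y_0-u$) has a Zariski dense set of solutions if and only if $u\notin\{0,1728\}$. -/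

import Mathlib

noncomputable section

/-- The modular `j`-function `j = E₄³ / Δ` on the upper half plane, where `E₄ = 1 + 240 q + ⋯` is
the normalised Eisenstein series and `Δ = q ∏ (1 - qⁿ)²⁴` (which never vanishes). It is the
`SL₂(ℤ)`-invariant holomorphic function with `q`-expansion `q⁻¹ + 744 + ∑_{k ≥ 1} a_k q^k`. -/
def modularJ (z : UpperHalfPlane) : ℂ :=
  ModularForm.E₄ z ^ 3 / ModularForm.discriminant z

/-- The `n`-th complex derivative of `j` at a point of the upper half plane. The function
`UpperHalfPlane.ofComplex` is the identity on the (open) upper half plane, so its values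
elsewhere play no role. -/
def modularJDeriv (n : ℕ) (z : UpperHalfPlane) : ℂ :=
  iteratedDeriv n (fun w : ℂ => modularJ (UpperHalfPlane.ofComplex w)) (z : ℂ)

/-- The point `(z, j(z), j'(z), j''(z))` of `ℂ⁴`. -/
def modularJPoint (z : UpperHalfPlane) : Fin 4 → ℂ :=
  ![(z : ℂ), modularJ z, modularJDeriv 1 z, modularJDeriv 2 z]

/-- For a polynomial `F` in the variables `X, Y₀, Y₁, Y₂` (numbered `0, 1, 2, 3`), the equation
`F(z, j(z), j'(z), j''(z)) = 0` has a Zariski dense set of solutions: for every polynomial `G`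
that fails to be divisible by some irreducible factor of `F`, there is a solution at which `G`
does not vanish. -/
def HasZariskiDenseSolutions (F : MvPolynomial (Fin 4) ℂ) : Prop :=
  ∀ G : MvPolynomial (Fin 4) ℂ,
    (∃ p : MvPolynomial (Fin 4) ℂ, Irreducible p ∧ p ∣ F ∧ ¬ p ∣ G) →
      ∃ z : UpperHalfPlane, MvPolynomial.eval (modularJPoint z) F = 0 ∧
        MvPolynomial.eval (modularJPoint z) G ≠ 0

end

/-! The zeros of `j'` are exactly the points where `j` is `0` or `1728`. For these `u`, `Y₁`
vanishes at every solution without being divisible by `Y₀ - u`. For any other `u`, surjectivity of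
`j` gives `z` with `j z = u` and `j' z ≠ 0`. The `SL₂(ℤ)`-orbit of its 2-jet is dense in the
hyperplane `Y₀ = u` (`X_sub_C_dvd_of_eval_jet_orbit_eq_zero`), because integer parameters can be
freed one at a time to complex ones. The zeros of `j'` come from `modularJDeriv_one`: `j'` is `E₄²
E₆ / Δ²` times a Rankin–Cohen bracket, which is a cusp form of weight 12, hence a nonzero multiple
of `Δ`. -/

/-! ### Zariski density of jet orbits. -/

theorem MvPolynomial.eval_curve_eq_zero_of_infinite {R σ : Type*} [CommRing R] [IsDomain R]
    (G : MvPolynomial σ R) (v : σ → Polynomial R) {S : Set R} (hS : S.Infinite)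
    (h : ∀ t ∈ S, eval (fun i => (v i).eval t) G = 0) (t : R) :
    eval (fun i => (v i).eval t) G = 0 := by
  have key : ∀ t, (aeval v G).eval t = eval (fun i => (v i).eval t) G := fun t => by
    rw [← Polynomial.coe_aeval_eq_eval, ← AlgHom.comp_apply, MvPolynomial.comp_aeval,
      ← MvPolynomial.coe_aeval_eq_eval]
    rfl
  have hzero : aeval v G = 0 :=
    Polynomial.eq_zero_of_infinite_isRoot _ (hS.mono fun t ht => (key t).trans (h t ht))
  rw [← key, hzero, Polynomial.eval_zero]

/-- Substituting `u` for `X i` does not change the class modulo `X i - C u`, and here it yields a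
polynomial vanishing everywhere, hence zero. -/
theorem MvPolynomial.X_sub_C_dvd_of_eval_eq_zero {R σ : Type*} [CommRing R] [IsDomain R]
    [Infinite R] (i : σ) (u : R) (G : MvPolynomial σ R)
    (h : ∀ x : σ → R, x i = u → eval x G = 0) : X i - C u ∣ G := by
  classical
  let φ : MvPolynomial σ R →ₐ[R] MvPolynomial σ R := aeval (Function.update X i (C u))
  have hφ : φ G = 0 := by
    refine MvPolynomial.funext fun x => ?_
    have : eval x (φ G) = eval (Function.update x i u) G := by
      simp only [φ, ← MvPolynomial.coe_aeval_eq_eval, RingHom.coe_coe]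
      rw [← AlgHom.comp_apply, MvPolynomial.comp_aeval]
      congr 2
      ext j
      rcases eq_or_ne j i with rfl | hj <;> simp [*]
    rw [this, h _ (by simp), map_zero]
  let I : Ideal (MvPolynomial σ R) := Ideal.span {X i - C u}
  have hcomp : (Ideal.Quotient.mkₐ R I).comp φ = Ideal.Quotient.mkₐ R I := by
    ext j
    rcases eq_or_ne j i with rfl | hj
    · simp only [φ, AlgHom.comp_apply, aeval_X, Function.update_self, Ideal.Quotient.mkₐ_eq_mk]
      refine (Ideal.Quotient.eq.mpr ?_).symm
      exact Ideal.mem_span_singleton_self _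
    · simp [φ, hj]
  have := DFunLike.congr_fun hcomp G
  rw [AlgHom.comp_apply, hφ, map_zero] at this
  exact Ideal.mem_span_singleton.mp (Ideal.Quotient.eq_zero_iff_mem.mp this.symm)

theorem MvPolynomial.eval_curve_eq_zero_of_infinite_fin_four {R : Type*} [CommRing R] [IsDomain R]
    (G : MvPolynomial (Fin 4) R) (p₀ p₁ p₂ p₃ : Polynomial R) {S : Set R} (hS : S.Infinite)
    (h : ∀ t ∈ S, eval ![p₀.eval t, p₁.eval t, p₂.eval t, p₃.eval t] G = 0) (t : R) :
    eval ![p₀.eval t, p₁.eval t, p₂.eval t, p₃.eval t] G = 0 := by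
  have key : ∀ t, (fun i => (![p₀, p₁, p₂, p₃] i).eval t) =
      ![p₀.eval t, p₁.eval t, p₂.eval t, p₃.eval t] := fun t => by
    funext i
    fin_cases i <;> rfl
  rw [← key]
  exact G.eval_curve_eq_zero_of_infinite _ hS (fun s hs => by rw [key]; exact h s hs) t

open Polynomial in
/-- The `SL₂(ℤ)`-orbit of a 2-jet with nonzero first derivative, under the transformation law of
2-jets of weight-zero modular functions, is Zariski dense in its hyperplane. -/
theorem X_sub_C_dvd_of_eval_jet_orbit_eq_zero (G : MvPolynomial (Fin 4) ℂ)
    {u z w₁ w₂ : ℂ} (hz : z.im ≠ 0) (hw : w₁ ≠ 0)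
    (h : ∀ a b c d : ℤ, a * d - b * c = 1 →
      MvPolynomial.eval ![(a * z + b) / (c * z + d), u, (c * z + d) ^ 2 * w₁,
        (c * z + d) ^ 4 * w₂ + 2 * c * (c * z + d) ^ 3 * w₁] G = 0) :
    MvPolynomial.X 1 - MvPolynomial.C u ∣ G := by
  have hden : ∀ {c d : ℤ}, c ≠ 0 → (c * z + d : ℂ) ≠ 0 := fun {c d} hc h0 => by
    have := congrArg Complex.im h0
    simp [hc, hz] at this
  have translate : ∀ c d : ℤ, c ≠ 0 → IsCoprime c d → ∀ x : ℂ,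
      MvPolynomial.eval ![x, u, (c * z + d) ^ 2 * w₁,
        (c * z + d) ^ 4 * w₂ + 2 * c * (c * z + d) ^ 3 * w₁] G = 0 := by
    rintro c d hc ⟨p, q, hpq⟩ x
    have hcd := hden (d := d) hc
    have := MvPolynomial.eval_curve_eq_zero_of_infinite_fin_four G
      (X) (C u) (C ((c * z + d) ^ 2 * w₁)) (C ((c * z + d) ^ 4 * w₂ + 2 * c * (c * z + d) ^ 3 * w₁))
      -- The matrices with bottom row `(c, d)` differ by integer translations, which move only the
      -- first coordinate.
      (S := Set.range fun n : ℤ => (q * z - p) / (c * z + d) + (n : ℂ))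
      (Set.infinite_range_of_injective fun m n hmn => by simpa using hmn) (by
        rintro _ ⟨n, rfl⟩
        have := h (q + n * c) (-p + n * d) c d (by linear_combination hpq)
        have hx : ((q + n * c : ℤ) * z + (-p + n * d : ℤ) : ℂ) / (c * z + d) =
            (q * z - p) / (c * z + d) + n := by
          push_cast
          field_simp
          ring
        rw [hx] at this
        simpa using this) x
    simpa using this
  have extend_d : ∀ c : ℤ, c ≠ 0 → ∀ x s : ℂ,
      MvPolynomial.eval ![x, u, s ^ 2 * w₁, s ^ 4 * w₂ + 2 * c * s ^ 3 * w₁] G = 0 := by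
    intro c hc x s
    have := MvPolynomial.eval_curve_eq_zero_of_infinite_fin_four G
      (C x) (C u) (X ^ 2 * C w₁) (X ^ 4 * C w₂ + C (2 * (c : ℂ)) * X ^ 3 * C w₁)
      -- Every `d = 1 + n * c` is coprime to `c`, so `s = c * z + d` takes infinitely many values
      -- for fixed `c`.
      (S := Set.range fun n : ℤ => c * z + ((1 + n * c : ℤ) : ℂ))
      (Set.infinite_range_of_injective fun m n hmn => by simpa [hc] using hmn) (by
        rintro _ ⟨n, rfl⟩
        have := translate c (1 + n * c) hc ⟨-n, 1, by ring⟩ x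
        simpa only [eval_add, eval_mul, eval_pow, eval_X, eval_C, eval_ofNat] using this) s
    simpa only [eval_add, eval_mul, eval_pow, eval_X, eval_C, eval_ofNat] using this
  have extend_c : ∀ x s c : ℂ,
      MvPolynomial.eval ![x, u, s ^ 2 * w₁, s ^ 4 * w₂ + 2 * c * s ^ 3 * w₁] G = 0 := by
    intro x s c
    have := MvPolynomial.eval_curve_eq_zero_of_infinite_fin_four G
      (C x) (C u) (C (s ^ 2 * w₁)) (C (s ^ 4 * w₂) + 2 * X * C (s ^ 3) * C w₁)
      (S := Int.cast '' {n : ℤ | n ≠ 0})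
      (Set.Infinite.image Int.cast_injective.injOn (Set.finite_singleton 0).infinite_compl) (by
        rintro _ ⟨n, hn, rfl⟩
        have := extend_d n hn x s
        simpa only [eval_add, eval_mul, eval_pow, eval_X, eval_C, eval_ofNat] using this) c
    simpa only [eval_add, eval_mul, eval_pow, eval_X, eval_C, eval_ofNat] using this
  have nonzero_y₁ : ∀ x y₁ y₂ : ℂ, y₁ ≠ 0 → MvPolynomial.eval ![x, u, y₁, y₂] G = 0 := by
    intro x y₁ y₂ hy
    -- Choose `s` to match `y₁`; then `y₂` is affine in `c` with slope `2 * s ^ 3 * w₁ ≠ 0`.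
    obtain ⟨s, hs⟩ := IsAlgClosed.exists_pow_nat_eq (y₁ / w₁) (n := 2) two_pos
    have hs0 : s ≠ 0 := by
      rintro rfl
      simp [hy, hw, eq_comm] at hs
    have hy1 : s ^ 2 * w₁ = y₁ := by rw [hs]; field_simp
    have hy2 : s ^ 4 * w₂ + 2 * ((y₂ - s ^ 4 * w₂) / (2 * s ^ 3 * w₁)) * s ^ 3 * w₁ = y₂ := by
      generalize s ^ 4 * w₂ = e
      field_simp
      ring
    have := extend_c x s ((y₂ - s ^ 4 * w₂) / (2 * s ^ 3 * w₁))
    rwa [hy1, hy2] at this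
  refine MvPolynomial.X_sub_C_dvd_of_eval_eq_zero 1 u G fun x hx => ?_
  have := MvPolynomial.eval_curve_eq_zero_of_infinite_fin_four G (C (x 0)) (C u) X (C (x 3))
      (S := {0}ᶜ) (Set.finite_singleton 0).infinite_compl (by
        intro t ht
        simpa only [eval_X, eval_C] using nonzero_y₁ (x 0) t (x 3) ht) (x 2)
  have hx' : x = ![x 0, u, x 2, x 3] := by
    funext i
    fin_cases i <;> simp [hx]
  rw [hx']
  simpa only [eval_X, eval_C] using this

/-! ### Behaviour at the cusp. -/

open UpperHalfPlane ModularForm MatrixGroups Filter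
open scoped Topology Manifold ModularForm Derivative

/-- If `f` is holomorphic and tends to a constant at `i∞`, then its derivative vanishes there. -/
theorem UpperHalfPlane.isZeroAtImInfty_normalizedDeriv {f : ℍ → ℂ} (hf : MDiff f) {l : ℂ}
    (hl : Tendsto f atImInfty (𝓝 l)) :
    IsZeroAtImInfty (Derivative.normalizedDerivOfComplex f) := by
  suffices h : IsZeroAtImInfty fun z : ℍ => deriv (f ∘ ofComplex) z by
    have := Filter.Tendsto.const_mul (2 * (Real.pi : ℂ) * Complex.I)⁻¹ h
    rwa [mul_zero] at this
  rw [isZeroAtImInfty_iff]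
  intro ε hε
  have h0 : IsZeroAtImInfty fun z => f z - l := by
    simpa [IsZeroAtImInfty, ZeroAtFilter] using hl.sub_const l
  obtain ⟨A, hA⟩ := isZeroAtImInfty_iff.mp h0 ε hε
  -- The closed unit disc about `z` then stays in `ℍ` and above height `A`, so Cauchy's estimate
  -- with radius 1 applies.
  refine ⟨max A 0 + 2, fun z hz => ?_⟩
  have him : ∀ w ∈ Metric.closedBall (z : ℂ) 1, max A 0 + 1 ≤ w.im := fun w hw => by
    have h1 : |(w - z).im| ≤ 1 :=
      (Complex.abs_im_le_norm _).trans (by simpa [dist_eq_norm] using hw)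
    rw [Complex.sub_im, coe_im, abs_le] at h1
    linarith [h1.1]
  have hpos : ∀ w ∈ Metric.closedBall (z : ℂ) 1, 0 < w.im := fun w hw => by
    linarith [him w hw, le_max_right A 0]
  have hd : DiffContOnCl ℂ (fun w => (f ∘ ofComplex) w - l) (Metric.ball (z : ℂ) 1) := by
    refine DifferentiableOn.diffContOnCl ?_
    rw [closure_ball _ one_ne_zero]
    exact ((UpperHalfPlane.mdifferentiable_iff.mp hf).mono hpos).sub_const l
  have := Complex.norm_deriv_le_of_forall_mem_sphere_norm_le one_pos hd (C := ε) fun w hw => by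
    have hw' := Metric.sphere_subset_closedBall hw
    simpa [ofComplex_apply_of_im_pos (hpos w hw')] using
      hA ⟨w, hpos w hw'⟩ (by
        have := him w hw'
        change A ≤ w.im
        linarith [le_max_left A 0])
  simpa only [deriv_sub_const_fun, div_one] using this

theorem UpperHalfPlane.tendsto_atImInfty_of_modularForm {k : ℤ} (f : ModularForm 𝒮ℒ k) :
    ∃ l, Tendsto f atImInfty (𝓝 l) := by
  have := (ModularFormClass.analyticAt_cuspFunction_zero f one_pos
    one_mem_strictPeriods_SL).continuousAt.tendsto.comp (qParam_tendsto_atImInfty one_pos)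
  refine ⟨_, this.congr fun z => ?_⟩
  exact SlashInvariantFormClass.eq_cuspFunction f z one_mem_strictPeriods_SL one_ne_zero

theorem ModularForm.tendsto_atImInfty_E {k : ℕ} (hk : 3 ≤ k) (hk2 : Even k) :
    Tendsto (E hk) atImInfty (𝓝 1) := by
  obtain ⟨l, hl⟩ := tendsto_atImInfty_of_modularForm (E hk)
  have h := EisensteinSeries.E_qExpansion_coeff_zero hk hk2
  rw [qExpansion_coeff_zero one_pos
    (ModularFormClass.analyticAt_cuspFunction_zero _ one_pos one_mem_strictPeriods_SL)
    (SlashInvariantFormClass.periodic_comp_ofComplex _ one_mem_strictPeriods_SL)] at h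
  rwa [← h, valueAtInfty, hl.limUnder_eq]

/-! ### The weight 12 bracket and surjectivity of `j`. -/

/-- The Rankin–Cohen bracket `2 E₄ E₆' - 3 E₆ E₄'`, with the normalised derivative. -/
noncomputable def bracketE₄E₆ : ℍ → ℂ :=
  (2 : ℂ) • (⇑E₄ * Derivative.normalizedDerivOfComplex E₆) -
    (3 : ℂ) • (⇑E₆ * Derivative.normalizedDerivOfComplex E₄)

theorem bracketE₄E₆_slash (γ : SL(2, ℤ)) : bracketE₄E₆ ∣[(12 : ℤ)] γ = bracketE₄E₆ := by
  have h4 : (E₄ : ℍ → ℂ) ∣[(4 : ℤ)] γ = E₄ := SlashInvariantFormClass.slash_action_eq E₄ _ ⟨γ, rfl⟩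
  have h6 : (E₆ : ℍ → ℂ) ∣[(6 : ℤ)] γ = E₆ := SlashInvariantFormClass.slash_action_eq E₆ _ ⟨γ, rfl⟩
  have d4 := Derivative.serreDerivative_slash_invariant (k := 4) E₄.holo' h4
  have d6 := Derivative.serreDerivative_slash_invariant (k := 6) E₆.holo' h6
  -- Passing to Serre derivatives is free: the `E₂` corrections cancel, as `2 * 6 = 3 * 4`.
  have hE : bracketE₄E₆ =
      (2 : ℂ) • (⇑E₄ * Derivative.serreDerivative (6 : ℤ) E₆) +
      (-3 : ℂ) • (⇑E₆ * Derivative.serreDerivative (4 : ℤ) E₄) := by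
    ext z
    simp [bracketE₄E₆]
    ring
  have m1 := ModularForm.mul_slash_SL2 4 (6 + 2) γ E₄ (Derivative.serreDerivative (6 : ℤ) E₆)
  have m2 := ModularForm.mul_slash_SL2 6 (4 + 2) γ E₆ (Derivative.serreDerivative (4 : ℤ) E₄)
  rw [h4, show Derivative.serreDerivative (6 : ℤ) E₆ ∣[(6 + 2 : ℤ)] γ = _ from d6] at m1
  rw [h6, show Derivative.serreDerivative (4 : ℤ) E₄ ∣[(4 + 2 : ℤ)] γ = _ from d4] at m2
  rw [hE, SlashAction.add_slash, ModularForm.SL_smul_slash, ModularForm.SL_smul_slash]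
  exact congrArg₂ (fun f g => (2 : ℂ) • f + (-3 : ℂ) • g) m1 m2

theorem bracketE₄E₆_isZeroAtImInfty : IsZeroAtImInfty bracketE₄E₆ := by
  have t4 := tendsto_atImInfty_E (k := 4) (by norm_num) ⟨2, rfl⟩
  have t6 := tendsto_atImInfty_E (k := 6) (by norm_num) ⟨3, rfl⟩
  have d4 := isZeroAtImInfty_normalizedDeriv E₄.holo' t4
  have d6 := isZeroAtImInfty_normalizedDeriv E₆.holo' t6
  have := ((t4.mul d6).const_mul (2 : ℂ)).sub ((t6.mul d4).const_mul (3 : ℂ))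
  simp only [mul_zero, sub_zero] at this
  exact this

/-- The bracket `2 E₄ E₆' - 3 E₆ E₄'` as a cusp form of weight 12. -/
noncomputable def CuspForm.bracketE₄E₆ : CuspForm 𝒮ℒ 12 where
  toFun := _root_.bracketE₄E₆
  slash_action_eq' := by
    rintro _ ⟨γ, rfl⟩
    exact bracketE₄E₆_slash γ
  holo' := by
    have h4 := Derivative.normalizedDerivOfComplex_mdifferentiable E₄.holo'
    have h6 := Derivative.normalizedDerivOfComplex_mdifferentiable E₆.holo'
    exact ((E₄.holo'.mul h6).const_smul 2).sub ((E₆.holo'.mul h4).const_smul 3)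
  zero_at_cusps' := by
    intro c hc
    rw [Subgroup.IsArithmetic.isCusp_iff_isCusp_SL2Z] at hc
    rw [OnePoint.isZeroAt_iff_forall_SL2Z hc]
    intro γ _
    rw [bracketE₄E₆_slash]
    exact bracketE₄E₆_isZeroAtImInfty

theorem exists_bracketE₄E₆_eq_mul_discriminant :
    ∃ c : ℂ, ∀ z, bracketE₄E₆ z = c * discriminant z := by
  obtain ⟨c, hc⟩ :=
    CuspForm.exists_smul_discriminant_of_weight_eq_twelve CuspForm.bracketE₄E₆
  exact ⟨c, fun z => (DFunLike.congr_fun hc z).symm⟩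

theorem modularJ_sub (z : ℍ) : modularJ z - 1728 = E₆ z ^ 2 / discriminant z := by
  have := discriminant_eq_E₄_cube_sub_E₆_sq z
  have h0 := discriminant_ne_zero z
  rw [modularJ]
  field_simp
  linear_combination -1728 * this

/-- The modular `j`-function is surjective. -/
theorem modularJ_surjective : Function.Surjective modularJ := by
  intro u
  by_contra! hu
  -- If `j` omits `u`, then `E₄³ - u Δ` has no zeros and tends to 1 at the cusp, so its inverse is a
  -- nonzero modular form of weight -12, which cannot exist.
  let f : ModularForm 𝒮ℒ 12 := ModularForm.mcast (by decide) (E₄.pow 3) -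
    u • (CuspForm.discriminant : ModularForm 𝒮ℒ 12)
  have hf : ∀ z, f z = E₄ z ^ 3 - u * discriminant z := fun z => by
    simp only [f, sub_apply, ModularForm.coe_mcast, ModularForm.coe_pow]
    rfl
  have hf0 : ∀ z, f z ≠ 0 := fun z hz => hu z <| by
    rw [hf, sub_eq_zero] at hz
    rw [modularJ, hz, mul_div_cancel_right₀ _ (discriminant_ne_zero z)]
  have hlim : Tendsto f atImInfty (𝓝 1) := by
    have t4 := (tendsto_atImInfty_E (k := 4) (by norm_num) ⟨2, rfl⟩).pow 3
    have := t4.sub (discriminant_isZeroAtImInfty.const_mul u)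
    simp only [one_pow, mul_zero, sub_zero] at this
    exact this.congr fun z => (hf z).symm
  have hslash : ∀ γ : SL(2, ℤ), (1 / ⇑f : ℍ → ℂ) ∣[(-12 : ℤ)] γ = 1 / ⇑f := fun γ => by
    have h := ModularForm.div_slash_SL2 0 12 γ 1 f
    rwa [ModularForm.is_invariant_one, show (f : ℍ → ℂ) ∣[(12 : ℤ)] γ = f from
      SlashInvariantFormClass.slash_action_eq f _ ⟨γ, rfl⟩] at h
  let g : ModularForm 𝒮ℒ (-12) := {
    toFun := 1 / ⇑f
    slash_action_eq' := by
      rintro _ ⟨γ, rfl⟩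
      exact hslash γ
    holo' := (mdifferentiable_const (c := (1 : ℂ))).div f.holo' hf0
    bdd_at_cusps' := by
      intro c hc
      rw [Subgroup.IsArithmetic.isCusp_iff_isCusp_SL2Z] at hc
      rw [OnePoint.isBoundedAt_iff_forall_SL2Z hc]
      intro γ _
      rw [hslash]
      exact ((hlim.inv₀ one_ne_zero).congr fun z => by simp).isBigO_one ℝ }
  have := ModularFormClass.levelOne_neg_weight_eq_zero (by norm_num) g
  exact one_div_ne_zero (hf0 I) (congrFun this I)

/-! ### Zeros of `j'`. -/

theorem hasDerivAt_comp_ofComplex {f : ℍ → ℂ} (hf : MDiff f) (z : ℍ) :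
    HasDerivAt (fun w : ℂ => f (ofComplex w)) (2 * Real.pi * Complex.I *
      Derivative.normalizedDerivOfComplex f z) z := by
  have h := (UpperHalfPlane.mdifferentiableAt_iff.mp (hf z)).hasDerivAt
  rw [Derivative.normalizedDerivOfComplex, mul_inv_cancel_left₀ Complex.two_pi_I_ne_zero]
  exact h

theorem mdifferentiable_modularJ : MDiff modularJ :=
  (E₄.holo'.pow 3).div CuspForm.discriminant.holo' discriminant_ne_zero

theorem modularJDeriv_one (z : ℍ) :
    modularJDeriv 1 z = 2 * Real.pi * Complex.I * E₄ z ^ 2 * E₆ z * bracketE₄E₆ z /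
      (1728 * discriminant z ^ 2) := by
  have h4 := hasDerivAt_comp_ofComplex (f := E₄) E₄.holo' z
  have h6 := hasDerivAt_comp_ofComplex (f := E₆) E₆.holo' z
  have hΔ := discriminant_ne_zero z
  have hΔe := discriminant_eq_E₄_cube_sub_E₆_sq z
  -- With `Δ` written through `E₄` and `E₆`, the quotient rule produces exactly the bracket.
  have hfun : (fun w : ℂ => modularJ (ofComplex w)) =
      fun w => E₄ (ofComplex w) ^ 3 / ((E₄ (ofComplex w) ^ 3 - E₆ (ofComplex w) ^ 2) / 1728) := by
    funext w
    rw [modularJ, discriminant_eq_E₄_cube_sub_E₆_sq]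
  have hd := (h4.fun_pow 3).fun_div (((h4.fun_pow 3).fun_sub (h6.fun_pow 2)).div_const 1728) (by
    rw [ofComplex_apply, ← hΔe]; exact hΔ)
  rw [modularJDeriv, iteratedDeriv_one, hfun, hd.deriv]
  simp only [ofComplex_apply, ← hΔe]
  simp only [bracketE₄E₆, Pi.sub_apply, Pi.smul_apply, Pi.mul_apply, smul_eq_mul]
  generalize Derivative.normalizedDerivOfComplex E₄ z = a
  generalize Derivative.normalizedDerivOfComplex E₆ z = b
  field_simp
  rw [hΔe]
  push_cast
  ring

/-- The derivative of `j` vanishes exactly at the points with `j = 0` or `j = 1728`. -/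
theorem modularJDeriv_one_eq_zero_iff (z : ℍ) :
    modularJDeriv 1 z = 0 ↔ modularJ z = 0 ∨ modularJ z = 1728 := by
  obtain ⟨c, hc⟩ := exists_bracketE₄E₆_eq_mul_discriminant
  -- Otherwise `j` would be constant on the connected set `ℍ`, yet it takes the values 0 and 1.
  have hc0 : c ≠ 0 := by
    rintro rfl
    have hd : ∀ w : ℂ, 0 < w.im → deriv (fun w : ℂ => modularJ (ofComplex w)) w = 0 :=
      fun w hw => by
        have := modularJDeriv_one ⟨w, hw⟩
        rw [hc] at this
        simpa [modularJDeriv] using this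
    obtain ⟨z₀, h₀⟩ := modularJ_surjective 0
    obtain ⟨z₁, h₁⟩ := modularJ_surjective 1
    have := isOpen_upperHalfPlaneSet.is_const_of_deriv_eq_zero
      (convex_halfSpace_im_gt 0).isPreconnected
      (UpperHalfPlane.mdifferentiable_iff.mp mdifferentiable_modularJ) hd z₀.im_pos z₁.im_pos
    simp [h₀, h₁] at this
  have hΔ := discriminant_ne_zero z
  have h1728 := modularJ_sub z
  rw [modularJDeriv_one, hc, ← sub_eq_zero (a := modularJ z) (b := 1728), h1728, modularJ]
  simp [hΔ, hc0, Real.pi_ne_zero]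

/-! ### Transformation law of the 2-jet of `j`. -/

theorem modularJ_smul (γ : SL(2, ℤ)) (z : ℍ) : modularJ (γ • z) = modularJ z := by
  have h := ModularForm.div_slash_SL2 12 12 γ ((E₄ : ℍ → ℂ) ^ 3) discriminant
  have h4 : ((E₄ : ℍ → ℂ) ^ 3) ∣[(12 : ℤ)] γ = (E₄ : ℍ → ℂ) ^ 3 :=
    (ModularForm.mcast (b := 12) (by decide) (E₄.pow 3) : ModularForm 𝒮ℒ 12).slash_action_eq'
      _ ⟨γ, rfl⟩
  have hΔ : discriminant ∣[(12 : ℤ)] γ = discriminant :=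
    SlashInvariantFormClass.slash_action_eq CuspForm.discriminant _ ⟨γ, rfl⟩
  rw [h4, hΔ] at h
  simpa [ModularForm.SL_slash_apply, modularJ] using congrFun h z

theorem denom_specialLinearGroup (γ : SL(2, ℤ)) (w : ℂ) :
    denom γ w = (γ 1 0 : ℂ) * w + γ 1 1 := by
  simp [denom]

theorem hasDerivAt_modularJDeriv (n : ℕ) (z : ℍ) :
    HasDerivAt (fun w : ℂ => modularJDeriv n (ofComplex w)) (modularJDeriv (n + 1) z) z := by
  have hd : AnalyticAt ℂ (fun w : ℂ => modularJ (ofComplex w)) z :=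
    (UpperHalfPlane.mdifferentiable_iff.mp mdifferentiable_modularJ).analyticAt
      (isOpen_upperHalfPlaneSet.mem_nhds z.im_pos)
  have := (hd.iterated_deriv n).differentiableAt.hasDerivAt
  rw [← iteratedDeriv_eq_iterate, ← iteratedDeriv_succ] at this
  refine this.congr_of_eventuallyEq ?_
  filter_upwards [isOpen_upperHalfPlaneSet.mem_nhds z.im_pos] with w hw
  rw [modularJDeriv, ofComplex_apply_of_im_pos hw]

/-- Chain rule: a Möbius map of determinant 1 has derivative `(c z + d)⁻²`. -/
theorem hasDerivAt_comp_smul_ofComplex {f f' : ℍ → ℂ}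
    (hf : ∀ z : ℍ, HasDerivAt (fun w : ℂ => f (ofComplex w)) (f' z) z) (γ : SL(2, ℤ)) (z : ℍ) :
    HasDerivAt (fun w : ℂ => f (γ • ofComplex w)) (f' (γ • z) / denom γ z ^ 2) z := by
  have hdet : (γ : GL (Fin 2) ℝ).val.det = 1 := by
    rw [← Matrix.GeneralLinearGroup.val_det_apply]
    simp
  have hγ := (hasStrictDerivAt_smul (g := (γ : GL (Fin 2) ℝ)) (hdet ▸ one_pos) z).hasDerivAt
  rw [hdet, Complex.ofReal_one, one_div] at hγ
  have hfγ := hf (γ • z)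
  have h := HasDerivAt.comp_of_eq (z : ℂ) hfγ hγ (by rw [ofComplex_apply]; rfl)
  refine (h.congr_of_eventuallyEq (.of_forall fun w => ?_))
  simp only [Function.comp_apply, ofComplex_apply]
  rfl

theorem modularJDeriv_zero (z : ℍ) : modularJDeriv 0 z = modularJ z := by
  simp [modularJDeriv]

theorem modularJDeriv_one_smul (γ : SL(2, ℤ)) (z : ℍ) :
    modularJDeriv 1 (γ • z) = denom γ z ^ 2 * modularJDeriv 1 z := by
  have h := hasDerivAt_comp_smul_ofComplex (hasDerivAt_modularJDeriv 0) γ z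
  simp only [modularJDeriv_zero, modularJ_smul] at h
  have h' := hasDerivAt_modularJDeriv 0 z
  simp only [modularJDeriv_zero] at h'
  have := h.unique h'
  rw [div_eq_iff (pow_ne_zero 2 (denom_ne_zero _ z))] at this
  rw [this, mul_comm]

/-- Differentiating the law for `j'`; the second term comes from the factor `(c z + d)²`. -/
theorem modularJDeriv_two_smul (γ : SL(2, ℤ)) (z : ℍ) :
    modularJDeriv 2 (γ • z) = denom γ z ^ 4 * modularJDeriv 2 z +
      2 * γ 1 0 * denom γ z ^ 3 * modularJDeriv 1 z := by
  have h := hasDerivAt_comp_smul_ofComplex (hasDerivAt_modularJDeriv 1) γ z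
  simp only [modularJDeriv_one_smul] at h
  have hcoe : HasDerivAt (fun w : ℂ => (ofComplex w : ℂ)) 1 z :=
    (hasDerivAt_id (z : ℂ)).congr_of_eventuallyEq (eventuallyEq_coe_comp_ofComplex z.im_pos)
  have hden : HasDerivAt (fun w : ℂ => denom γ (ofComplex w)) (γ 1 0) z := by
    simp only [denom_specialLinearGroup]
    simpa using (hcoe.const_mul (γ 1 0 : ℂ)).add_const (γ 1 1 : ℂ)
  have := h.unique ((hden.fun_pow 2).fun_mul (hasDerivAt_modularJDeriv 1 z))
  rw [div_eq_iff (pow_ne_zero 2 (denom_ne_zero _ z)), ofComplex_apply] at this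
  rw [this]
  push_cast
  ring

/-! ### The corollary. -/

theorem eval_modularJPoint_X_sub_C (u : ℂ) (z : ℍ) :
    MvPolynomial.eval (modularJPoint z) (MvPolynomial.X 1 - MvPolynomial.C u) =
      modularJ z - u := by
  simp [modularJPoint]

theorem MvPolynomial.irreducible_X_sub_C {R σ : Type*} [CommRing R] [IsDomain R] (i : σ) (u : R) :
    Irreducible (X i - C u : MvPolynomial σ R) := by
  classical
  have hcoeff : coeff (Finsupp.single i 1) (X i - C u : MvPolynomial σ R) = 1 := by
    rw [coeff_sub, coeff_X, coeff_C, if_pos rfl,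
      if_neg (Finsupp.single_ne_zero.mpr one_ne_zero).symm, sub_zero]
  -- The coefficient 1 of `X i` excludes nonunit constant factors.
  refine irreducible_of_totalDegree_eq_one (le_antisymm ?_ ?_) fun x hx =>
    isUnit_of_dvd_one (hcoeff ▸ hx _)
  · exact (totalDegree_sub _ _).trans (by simp)
  · have := le_totalDegree (p := (X i - C u : MvPolynomial σ R)) (s := Finsupp.single i 1)
      (by simp [mem_support_iff, hcoeff])
    simpa using this

theorem modularJPoint_specialLinearGroup_smul {a b c d : ℤ} (h : a * d - b * c = 1) (z : ℍ) :
    ∃ z' : ℍ, modularJPoint z' = ![(a * (z : ℂ) + b) / (c * z + d), modularJ z,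
      (c * z + d) ^ 2 * modularJDeriv 1 z,
      (c * z + d) ^ 4 * modularJDeriv 2 z + 2 * c * (c * z + d) ^ 3 * modularJDeriv 1 z] := by
  let γ : SL(2, ℤ) := ⟨!![a, b; c, d], by rw [Matrix.det_fin_two_of, h]⟩
  refine ⟨γ • z, ?_⟩
  have hz : ((γ • z : ℍ) : ℂ) = (a * z + b) / (c * z + d) := by
    rw [UpperHalfPlane.specialLinearGroup_apply]
    simp [γ]
  rw [modularJPoint, hz, modularJ_smul, modularJDeriv_one_smul, modularJDeriv_two_smul,
    denom_specialLinearGroup]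
  simp [γ]

theorem corollary6p3 (u : ℂ) :
    HasZariskiDenseSolutions (MvPolynomial.X 1 - MvPolynomial.C u) ↔
      u ∉ ({0, 1728} : Set ℂ) := by
  constructor
  · intro hdense hu
    obtain ⟨z, hz, hG⟩ := hdense (MvPolynomial.X 2)
      -- At `(0, u, 1, 0)` divisibility would read `0 ∣ 1`.
      ⟨_, MvPolynomial.irreducible_X_sub_C 1 u, dvd_rfl, fun hdvd => by
        simpa using map_dvd (MvPolynomial.eval ![0, u, 1, 0]) hdvd⟩
    rw [eval_modularJPoint_X_sub_C, sub_eq_zero] at hz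
    have h0 := (modularJDeriv_one_eq_zero_iff z).mpr (hz ▸ hu)
    exact hG (by simpa [modularJPoint] using h0)
  · rintro hu G ⟨p, -, hp, hpG⟩
    by_contra! hG
    obtain ⟨z, hz⟩ := modularJ_surjective u
    have hw : modularJDeriv 1 z ≠ 0 := fun h0 =>
      hu (hz ▸ (modularJDeriv_one_eq_zero_iff z).mp h0)
    refine hpG (hp.trans (X_sub_C_dvd_of_eval_jet_orbit_eq_zero G (w₂ := modularJDeriv 2 z)
      z.im_ne_zero hw fun a b c d h => ?_))
    obtain ⟨z', hz'⟩ := modularJPoint_specialLinearGroup_smul h z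
    rw [hz] at hz'
    rw [← hz']
    refine hG z' ?_
    simp [hz']
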